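/- **Lemma (Classical Hardness of Claw-Finding).** *Interactive hashing.* A stateless interactive hashing protocol over $[k]$ is a protocol between a public-coin Alice, whose random coins $h=(h_1,\dots,h_r)$ are revealed one per round, and Bob, whose honest answer in round $i$ is a deterministic function of his input $v\in[k]$ and of $h_i$. Write $h(v)$ for the tuple of honest answers. For every $h$ that occurs and every tuple $y$ of answers it is required that $|h^{-1}(y)|=2$. The protocol is $(\alpha,\beta)$-secure if for every $B\subseteq[k]$ with $|B|\le\beta k$ and every (randomized, computationally unbounded, with unbounded memory) strategy of Bob, the resulting transcript $(h,y)$ satisfies $\Pr(h^{-1}(y)\subseteq B)\le\alpha$. *The protocol.* Let $\lambda$ be a security parameter, $k$ a stream length, and fix a stateless interactive hashing protocol over $[k]$. The verifier and the prover perform $\lambda$ rounds. Round $j$ consists of repeated attempts, until the first success. In an attempt the verifier samples uniform $v_0,v_1\gets[k]$ and a uniform $U\in\{0,1\}^k$ and sends $U$ bit by bit; then the parties run interactive hashing (the verifier is Alice, the prover is Bob), with transcript $(h,y)$. The attempt succeeds if $h^{-1}(y)=\{v_0,v_1\}$, and then the verifier stores $z^j_0=U_{v_0}$ and $z^j_1=U_{v_1}$;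 otherwise the verifier starts over with a new attempt. Let $Z_b=(z_b^1,\dots,z_b^\lambda)$ for $b\in\{0,1\}$. *The adversary.* A non-uniform classical adversary with $m$ bits of memory plays the prover: on each message it applies an arbitrary randomized map (which may depend on the position in the protocol) to the message and its $m$-bit memory, and obtains its new $m$-bit memory and, during interactive hashing, its answer. Let $W$ be its memory right after the interactive hashing of the successful attempt of round $\lambda$. *Claim.* For all constants $C,c>0$ there are a constant $c'>0$ and a $\lambda_0$, which depend only on $C$ and $c$, such that the following holds for all $\lambda\ge\lambda_0$, all $m$ and all $k$ with $$\frac{k}{\log k}>\lambda\,(m+c\lambda).$$ If the interactive hashing protocol over $[k]$ is $(C\beta\log k,\beta)$-secure for every $\beta>0$, then for every classical adversary with $m$ bits of memory $$H_\infty(Z_0,Z_1\mid W)\ \ge\ c'\lambda .$$ Here $\log$ is to base $2$ and $H_\infty(X\mid Y)=-\log\,\mathbb{E}_{y\gets Y}\big[\max_x\Pr(X=x\mid Y=y)\big]$. -/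

import Mathlib

/-!
Claw generation by interactive hashing against a classical adversary with bounded memory.
Indices `[k]` are `Fin k`, and all randomness is described by discrete probability
distributions (`PMF`).
-/

noncomputable section

namespace ClawGen

/-! ### Conditional min-entropy -/

/-- The conditional min-entropy `H_∞(X ∣ Y) = -log₂ 𝔼_{y ← Y} max_x Pr(X = x ∣ Y = y)` of a pair
of finite random variables `(X, Y)` with joint law `p`. -/
def condMinEntropy {α β : Type} [Fintype β] (p : PMF (α × β)) : ℝ :=
  -Real.logb 2 (∑ y : β, (p.map Prod.snd y).toReal *
    ⨆ x : α, (p (x, y)).toReal / (p.map Prod.snd y).toReal)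

/-! ### Sequential interaction of a stateful party -/

/-- A party with state space `σ` performs the `n` randomized steps `step 0, …, step (n-1)`; the
result is its final state. -/
def runSteps {σ : Type} : (n : ℕ) → (Fin n → σ → PMF σ) → σ → PMF σ
  | 0, _, s => PMF.pure s
  | n + 1, step, s => (step 0 s).bind fun s' => runSteps n (fun i => step i.succ) s'

/-- A party with state space `σ` performs the `n` randomized steps `step 0, …, step (n-1)`, where
step `i` also emits a message in `Ans i`; the result consists of all messages and the final
state. -/
def interact {σ : Type} : (n : ℕ) → (Ans : Fin n → Type) →
    ((i : Fin n) → σ → PMF (Ans i × σ)) → σ → PMF (((i : Fin n) → Ans i) × σ)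
  | 0, _, _, s => PMF.pure (fun i => i.elim0, s)
  | n + 1, Ans, step, s =>
      (step 0 s).bind fun as =>
        (interact n (fun i => Ans i.succ) (fun i => step i.succ) as.2).map
          fun ys => (Fin.cons as.1 ys.1, ys.2)

/-! ### Interactive hashing -/

/-- A stateless interactive hashing protocol over `[k]`. Alice draws public coins
`h = (h₀, …, h_{r-1})` and reveals `h_i` in round `i`; honest Bob with input `v` answers
`reply i (h_i) v`. With `h(v)` the tuple of all these answers, `h` is 2-to-1: every tuple `y` of
answers has exactly two preimages. -/
structure InteractiveHashing (k : ℕ) where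
  rounds : ℕ
  Coin : Fin rounds → Type
  Ans : Fin rounds → Type
  coins : PMF ((i : Fin rounds) → Coin i)
  reply : (i : Fin rounds) → Coin i → Fin k → Ans i
  two_to_one : ∀ h ∈ coins.support, ∀ y : (i : Fin rounds) → Ans i,
    {v : Fin k | ∀ i, reply i (h i) v = y i}.ncard = 2

/-- The set `h⁻¹(y)` of inputs on which honest Bob answers `y` to the public coins `h`. -/
def InteractiveHashing.preimage {k : ℕ} (H : InteractiveHashing k)
    (h : (i : Fin H.rounds) → H.Coin i) (y : (i : Fin H.rounds) → H.Ans i) : Set (Fin k) :=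
  {v | ∀ i, H.reply i (h i) v = y i}

/-- The transcript `(h, y)` and Bob's final state in an execution with an arbitrary (randomized)
Bob, who has state space `σ`, initial state `s`, and who in round `i` maps the coins `h_i` and his
current state to an answer and a new state. -/
def InteractiveHashing.execute {k : ℕ} (H : InteractiveHashing k) {σ : Type}
    (bob : (i : Fin H.rounds) → H.Coin i → σ → PMF (H.Ans i × σ)) (s : σ) :
    PMF (((i : Fin H.rounds) → H.Coin i) × ((i : Fin H.rounds) → H.Ans i) × σ) :=
  H.coins.bind fun h => (interact H.rounds H.Ans (fun i => bob i (h i)) s).map fun ys => (h, ys)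

/-- `(α, β)`-security: for every set `B ⊆ [k]` of size at most `β k` and every strategy of Bob,
with unbounded computation and an arbitrary state space, `Pr(h⁻¹(y) ⊆ B) ≤ α`. -/
def InteractiveHashing.IsSecure {k : ℕ} (H : InteractiveHashing k) (α β : ℝ) : Prop :=
  ∀ B : Finset (Fin k), (B.card : ℝ) ≤ β * k →
    ∀ (σ : Type) (bob : (i : Fin H.rounds) → H.Coin i → σ → PMF (H.Ans i × σ)) (s : σ),
      (H.execute bob s).toOuterMeasure {x | H.preimage x.1 x.2.1 ⊆ (B : Set (Fin k))}
        ≤ ENNReal.ofReal α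

/-! ### Repetition until success -/

section Repeat

theorem tsum_opt {α : Type} (f : Option α → ENNReal) :
    ∑' o, f o = f none + ∑' z, f (some z) := by
  classical
  rw [ENNReal.tsum_eq_add_tsum_ite none]
  congr 1
  rw [← (Option.some_injective α).tsum_eq]
  · simp
  · intro o ho
    cases o with
    | none => simp at ho
    | some z => exact ⟨z, rfl⟩

variable {σ ρ : Type} (f : ℕ → σ → PMF (Option ρ × σ))

/-- `pending f s a t` is the probability that attempts `0, …, a-1` all fail and leave the state
`t`, when attempt `b` is described by `f b` (a result, or `none` for a failure, together with the
new state) and the initial state is `s`. -/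
def pending (s : σ) : ℕ → σ → ENNReal
  | 0 => fun t => PMF.pure s t
  | a + 1 => fun t => ∑' t', pending s a t' * f a t' (none, t)

theorem attempt_mass (a : ℕ) (t' : σ) :
    (∑' x : ρ × σ, f a t' (some x.1, x.2)) + ∑' t, f a t' (none, t) = 1 := by
  have h := (f a t').tsum_coe
  rw [ENNReal.tsum_prod', tsum_opt] at h
  rw [ENNReal.tsum_prod', add_comm]
  exact h

theorem pending_step (s : σ) (a : ℕ) :
    (∑' x : ρ × σ, ∑' t', pending f s a t' * f a t' (some x.1, x.2))
      + ∑' t, pending f s (a + 1) t = ∑' t, pending f s a t := by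
  simp only [pending]
  rw [ENNReal.tsum_comm, ENNReal.tsum_comm (f := fun t t' => pending f s a t' * f a t' (none, t)),
    ← ENNReal.tsum_add]
  refine tsum_congr fun t' => ?_
  rw [ENNReal.tsum_mul_left, ENNReal.tsum_mul_left, ← mul_add, attempt_mass, mul_one]

theorem pending_le {δ : ENNReal} (hf : ∀ a t, ∑' t', f a t (none, t') ≤ δ) (s : σ) (a : ℕ) :
    ∑' t, pending f s a t ≤ δ ^ a := by
  induction a with
  | zero => simp [pending]
  | succ a ih =>
    simp only [pending]
    rw [ENNReal.tsum_comm]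
    simp only [ENNReal.tsum_mul_left]
    calc ∑' t', pending f s a t' * ∑' t, f a t' (none, t)
        ≤ ∑' t', pending f s a t' * δ :=
          ENNReal.tsum_le_tsum fun t' => mul_le_mul_right (hf a t') _
      _ = (∑' t', pending f s a t') * δ := ENNReal.tsum_mul_right
      _ ≤ δ ^ a * δ := mul_le_mul_left ih _
      _ = δ ^ (a + 1) := (pow_succ _ _).symm

theorem repeat_mass {δ : ENNReal} (hδ : δ < 1) (hf : ∀ a t, ∑' t', f a t (none, t') ≤ δ) (s : σ) :
    ∑' x : ℕ × ρ × σ, ∑' t, pending f s x.1 t * f x.1 t (some x.2.1, x.2.2) = 1 := by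
  rw [ENNReal.tsum_prod']
  set T : ℕ → ENNReal := fun a =>
    ∑' x : ρ × σ, ∑' t, pending f s a t * f a t (some x.1, x.2) with hT
  have hsum : ∀ n, (∑ a ∈ Finset.range n, T a) + ∑' t, pending f s n t = 1 := by
    intro n
    induction n with
    | zero => simp [pending]
    | succ n ih => rw [Finset.sum_range_succ, add_assoc, hT, pending_step f s n]; exact ih
  have h1 : Filter.Tendsto (fun n => ∑ a ∈ Finset.range n, T a) Filter.atTop
      (nhds (∑' a, T a)) := ENNReal.tendsto_nat_tsum T
  have h2 : Filter.Tendsto (fun n => ∑' t, pending f s n t) Filter.atTop (nhds 0) :=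
    tendsto_of_tendsto_of_tendsto_of_le_of_le tendsto_const_nhds
      (ENNReal.tendsto_pow_atTop_nhds_zero_of_lt_one hδ) (fun _ => zero_le) (pending_le f hf s)
  have h3 := h1.add h2
  simp only [hsum, add_zero] at h3
  exact (tendsto_nhds_unique h3 tendsto_const_nhds)

/-- Repeat the attempts `f 0, f 1, …`, each starting in the state that the previous one left, until
the first attempt that succeeds. The outcome is the index of that attempt, its result and the state
it leaves. All attempts fail with probability at most `δ < 1`, so this is a probability
distribution. -/
def repeatUntil {δ : ENNReal} (hδ : δ < 1) (hf : ∀ a t, ∑' t', f a t (none, t') ≤ δ) (s : σ) :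
    PMF (ℕ × ρ × σ) :=
  ⟨fun x => ∑' t, pending f s x.1 t * f x.1 t (some x.2.1, x.2.2), by
    rw [← repeat_mass f hδ hf s]; exact ENNReal.summable.hasSum⟩

end Repeat

/-! ### Adversaries and the protocol -/

/-- The adversary's memory: `m` bits. -/
abbrev Memory (m : ℕ) : Type := Fin m → Bool

/-- The position of an attempt in the protocol: `past` lists, for each completed round, the index
of its successful attempt, and `attempt` is the number of failed attempts of the current round. -/
structure Position where
  past : List ℕ
  attempt : ℕ

/-- A non-uniform, computationally unbounded, randomized classical adversary with `m` bits of
memory. On each message of the verifier it applies an arbitrary randomized map to the message and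
its memory, which yields its new memory and, during interactive hashing, its answer. These maps may
depend on the position in the protocol; in particular, the verifier's decision to accept an attempt
or to start over is known to the adversary, at no cost in memory. -/
structure Adversary (m : ℕ) {k : ℕ} (H : InteractiveHashing k) where
  /-- The initial memory. -/
  init : PMF (Memory m)
  /-- The reaction to the `i`-th bit of the stream. -/
  read : Position → (i : Fin k) → Bool → Memory m → PMF (Memory m)
  /-- The reaction to the coins of the `i`-th round of interactive hashing. -/
  answer : Position → (i : Fin H.rounds) → H.Coin i → Memory m → PMF (H.Ans i × Memory m)

theorem fail_bound_lt_one {k : ℕ} : 1 - (k : ENNReal)⁻¹ * (k : ENNReal)⁻¹ < 1 := by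
  refine ENNReal.sub_lt_self ENNReal.one_ne_top one_ne_zero ?_
  simp [ENNReal.inv_eq_zero]

section Protocol

variable {m k : ℕ} [NeZero k] (H : InteractiveHashing k) (A : Adversary m H)

open Classical in
/-- One attempt at a 1-bit claw, from memory `w`: the verifier draws uniform indices `v₀, v₁` and a
uniform stream `U`, and sends `U` bit by bit; then the parties run interactive hashing, with
transcript `(h, y)`. If `h⁻¹(y) = {v₀, v₁}` the attempt succeeds and the verifier stores
`(U_{v₀}, U_{v₁})`; otherwise it fails. The second component is the adversary's memory right after
interactive hashing. -/
def attempt (pos : Position) (w : Memory m) : PMF (Option (Bool × Bool) × Memory m) :=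
  (PMF.uniformOfFintype (Fin k)).bind fun v₀ =>
  (PMF.uniformOfFintype (Fin k)).bind fun v₁ =>
  (PMF.uniformOfFintype (Fin k → Bool)).bind fun U =>
  (runSteps k (fun i => A.read pos i (U i)) w).bind fun wpre =>
  (H.execute (A.answer pos) wpre).map fun x =>
    (if H.preimage x.1 x.2.1 = {v₀, v₁} then some (U v₀, U v₁) else none, x.2.2)

theorem bind_apply_le {α β : Type} (p : PMF α) (f : α → PMF β) (b : β) (δ : ENNReal)
    (h : ∀ a ∈ p.support, f a b ≤ δ) : p.bind f b ≤ δ := by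
  rw [PMF.bind_apply]
  calc ∑' a, p a * f a b ≤ ∑' a, p a * δ := by
        refine ENNReal.tsum_le_tsum fun a => ?_
        by_cases ha : p a = 0
        · simp [ha]
        · exact mul_le_mul_right (h a ((PMF.mem_support_iff _ _).2 ha)) _
    _ = δ := by rw [ENNReal.tsum_mul_right, p.tsum_coe, one_mul]

open Classical in
theorem guess_fail_le (S : Set (Fin k)) (hS : S.ncard = 2) (U : Fin k → Bool) :
    ((PMF.uniformOfFintype (Fin k)).bind fun v₀ => (PMF.uniformOfFintype (Fin k)).bind fun v₁ =>
      PMF.pure (if S = {v₀, v₁} then some (U v₀, U v₁) else none)) none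
        ≤ 1 - (k : ENNReal)⁻¹ * (k : ENNReal)⁻¹ := by
  obtain ⟨a, b, -, hab⟩ := Set.ncard_eq_two.1 hS
  set X := (PMF.uniformOfFintype (Fin k)).bind fun v₀ =>
    (PMF.uniformOfFintype (Fin k)).bind fun v₁ =>
      PMF.pure (if S = {v₀, v₁} then some (U v₀, U v₁) else none) with hX
  have h1 := X.tsum_coe
  rw [tsum_opt] at h1
  have h2 : (k : ENNReal)⁻¹ * (k : ENNReal)⁻¹ ≤ ∑' z, X (some z) := by
    refine le_trans ?_ (ENNReal.le_tsum (U a, U b))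
    rw [hX, PMF.bind_apply]
    refine le_trans ?_ (ENNReal.le_tsum a)
    rw [PMF.bind_apply, PMF.uniformOfFintype_apply, Fintype.card_fin]
    refine mul_le_mul_right (le_trans ?_ (ENNReal.le_tsum b)) _
    simp [hab]
  have h3 : (∑' z, X (some z)) ≠ ⊤ := ne_top_of_le_ne_top ENNReal.one_ne_top (h1 ▸ le_add_self)
  calc X none = 1 - ∑' z, X (some z) := ENNReal.eq_sub_of_add_eq h3 h1
    _ ≤ _ := tsub_le_tsub_left h2 1

/-- An attempt fails with probability at most `1 - k⁻¹ k⁻¹`. -/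
theorem attempt_fail_le (pos : Position) (w : Memory m) :
    ∑' w', attempt H A pos w (none, w') ≤ 1 - (k : ENNReal)⁻¹ * (k : ENNReal)⁻¹ := by
  classical
  have h0 : ∑' w', attempt H A pos w (none, w') = (attempt H A pos w).map Prod.fst none := by
    rw [PMF.map_apply, ENNReal.tsum_prod']
    rw [tsum_eq_single none]
    · simp
    · intro o ho
      simp [Ne.symm ho]
  rw [h0]
  have h1 : (attempt H A pos w).map Prod.fst =
      (PMF.uniformOfFintype (Fin k → Bool)).bind fun U =>
      (runSteps k (fun i => A.read pos i (U i)) w).bind fun wpre =>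
      (H.execute (A.answer pos) wpre).bind fun x =>
      (PMF.uniformOfFintype (Fin k)).bind fun v₀ =>
      (PMF.uniformOfFintype (Fin k)).bind fun v₁ =>
      PMF.pure (if H.preimage x.1 x.2.1 = {v₀, v₁} then some (U v₀, U v₁) else none) := by
    have h2 : (attempt H A pos w).map Prod.fst =
        (PMF.uniformOfFintype (Fin k)).bind fun v₀ =>
        (PMF.uniformOfFintype (Fin k)).bind fun v₁ =>
        (PMF.uniformOfFintype (Fin k → Bool)).bind fun U =>
        (runSteps k (fun i => A.read pos i (U i)) w).bind fun wpre =>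
        (H.execute (A.answer pos) wpre).bind fun x =>
        PMF.pure (if H.preimage x.1 x.2.1 = {v₀, v₁} then some (U v₀, U v₁) else none) := by
      simp only [attempt, PMF.map_bind, PMF.map_comp]
      rfl
    rw [h2]
    calc _ = (PMF.uniformOfFintype (Fin k)).bind fun v₀ =>
          (PMF.uniformOfFintype (Fin k → Bool)).bind fun U =>
          (runSteps k (fun i => A.read pos i (U i)) w).bind fun wpre =>
          (H.execute (A.answer pos) wpre).bind fun x =>
          (PMF.uniformOfFintype (Fin k)).bind fun v₁ =>
          PMF.pure (if H.preimage x.1 x.2.1 = {v₀, v₁} then some (U v₀, U v₁) else none) := by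
          congr 1; funext v₀
          rw [PMF.bind_comm]
          congr 1; funext U
          rw [PMF.bind_comm]
          congr 1; funext wpre
          rw [PMF.bind_comm]
      _ = _ := by
          rw [PMF.bind_comm]
          congr 1; funext U
          rw [PMF.bind_comm]
          congr 1; funext wpre
          rw [PMF.bind_comm]
  rw [h1]
  refine bind_apply_le _ _ _ _ fun U _ => bind_apply_le _ _ _ _ fun wpre _ =>
    bind_apply_le _ _ _ _ fun x hx => guess_fail_le _ ?_ U
  simp only [InteractiveHashing.execute, PMF.mem_support_bind_iff, PMF.mem_support_map_iff] at hx
  obtain ⟨h, hh, ys, -, rfl⟩ := hx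
  exact H.two_to_one h hh ys.1

/-- A round: attempts are repeated until the first success. The outcome is the index of the
successful attempt, the pair `(z₀, z₁)` stored by the verifier, and the adversary's memory right
after interactive hashing in the successful attempt. -/
def round (past : List ℕ) (w : Memory m) : PMF (ℕ × (Bool × Bool) × Memory m) :=
  repeatUntil (fun a => attempt H A ⟨past, a⟩) (fail_bound_lt_one (k := k))
    (fun a => attempt_fail_le H A ⟨past, a⟩) w

/-- The first `j` rounds: the indices of the successful attempts, the pairs `(z₀, z₁)` stored by
the verifier, and the adversary's memory right after interactive hashing in the last of these
rounds. -/
def run : (j : ℕ) → PMF (List ℕ × (Fin j → Bool × Bool) × Memory m)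
  | 0 => A.init.map fun w => ([], fun i => i.elim0, w)
  | j + 1 => (run j).bind fun x => (round H A x.1 x.2.2).map fun y =>
      (x.1 ++ [y.1], Fin.snoc x.2.1 y.2.1, y.2.2)

/-- The joint law of `((Z₀, Z₁), W)` after `n` rounds, where `Z_b = (z_b^1, …, z_b^n)` and `W` is
the adversary's memory right after interactive hashing in round `n`. -/
def clawLaw (n : ℕ) : PMF (((Fin n → Bool) × (Fin n → Bool)) × Memory m) :=
  (run H A n).map fun x => ((fun j => (x.2.1 j).1, fun j => (x.2.1 j).2), x.2.2)

end Protocol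

end ClawGen

end

/-!
The law of a round factors because the indices `v₀, v₁` are independent of the stream, of the
adversary's memory and of the transcript. An attempt therefore succeeds with probability exactly
`2 / k²`, whatever the adversary does (`attempt_success`), and success does not bias the pair
(stream, memory after the stream); this is the content of `attempt_some_apply`.

Fix the memory at the start of an attempt. The memory `w` after the stream is a randomized function
of the uniform stream `U`; call a bit of `U` predictable from `w` if, given `w`, one of its values
has probability above `3/4`. A Chernoff-type moment argument bounds the number of predictable bits by `8 log (1 / Pr w)`
(`card_le_of_predictable`), so that its mean is at most `8` times the entropy of `w`, hence `O(m)`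
(`sum_card_predictable_le`). By security of interactive hashing for the set `B` of predictable bits,
both preimages of the transcript fall into `B` with probability `O(C |B| log k / k)`, which is
`O(C / λ)` on average. Otherwise one of the two stored bits is guessed with probability at most
`3/4`. For `λ ≥ 64 C` the pair of stored bits is thus guessed with probability at most `7/8`, for
every starting memory (`attempt_guess_le`, `round_guess_le`).

Given the memory between rounds, the pairs of different rounds are independent, so the guessing
probability is submultiplicative over rounds (`run_guess_le`), even for a guesser who knows the
indices of the successful attempts. After `λ` rounds it is at most `(7/8)^λ`.
-/

noncomputable section

namespace ClawGen

/-! ### Bits that a short memory can predict -/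

section Bias

variable {ι σ : Type} [Fintype ι] [DecidableEq ι]

/-- The exponential moment of `∑_{v ∈ B} ±1`, where the sign of `v` says whether the uniform bit
`U v` equals `s v`. -/
theorem sum_exp_signs_le (B : Finset ι) (s : ι → Bool) (t : ℝ) :
    ((2 : ℝ) ^ Fintype.card ι)⁻¹ *
      ∑ U : ι → Bool, Real.exp (t * ∑ v ∈ B, if U v = s v then 1 else -1)
        ≤ Real.exp (B.card * (t ^ 2 / 2)) := by
  have h1 : ∀ U : ι → Bool, Real.exp (t * ∑ v ∈ B, if U v = s v then (1 : ℝ) else -1) =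
      ∏ v, if v ∈ B then Real.exp (t * if U v = s v then 1 else -1) else 1 := by
    intro U
    rw [Finset.mul_sum, Real.exp_sum]
    simp
  have h2 : ∑ U : ι → Bool, Real.exp (t * ∑ v ∈ B, if U v = s v then (1 : ℝ) else -1) =
      ∏ v, ∑ b : Bool, if v ∈ B then Real.exp (t * if b = s v then 1 else -1) else 1 := by
    rw [Finset.prod_univ_sum, Fintype.piFinset_univ]
    exact Finset.sum_congr rfl fun U _ => h1 U
  have h3 : ∀ v, (∑ b : Bool, if v ∈ B then Real.exp (t * if b = s v then 1 else -1) else 1) =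
      2 * if v ∈ B then Real.cosh t else 1 := by
    intro v
    by_cases hv : v ∈ B
    · cases hs : s v <;> simp [hv, Real.cosh_eq] <;> ring
    · simp [hv]
  rw [h2, Finset.prod_congr rfl fun v _ => h3 v, Finset.prod_mul_distrib]
  simp only [Finset.prod_const, Finset.card_univ, Finset.prod_ite_mem, Finset.univ_inter]
  rw [← mul_assoc, inv_mul_cancel₀ (by positivity), one_mul, Real.exp_nat_mul]
  exact pow_le_pow_left₀ (Real.cosh_pos t).le (Real.cosh_le_exp_half_sq t) _

/-- If an event of probability `p` (weighted by `r`) makes every bit in `B` of a uniform string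
predictable with probability `3/4`, then `|B| ≤ 8 log (1/p)`: conditioned on the event, the number
of correct minus incorrect predictions has mean at least `|B|/2`, and Jensen's inequality compares
this with the unconditional exponential moment. -/
theorem card_le_of_predictable (r : (ι → Bool) → ℝ) (hr0 : ∀ U, 0 ≤ r U) (hr1 : ∀ U, r U ≤ 1)
    (p : ℝ) (hp : 0 < p) (hpr : p = ∑ U, ((2 : ℝ) ^ Fintype.card ι)⁻¹ * r U)
    (B : Finset ι) (s : ι → Bool)
    (hB : ∀ v ∈ B, 3 / 4 * p ≤ ∑ U with U v = s v, ((2 : ℝ) ^ Fintype.card ι)⁻¹ * r U) :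
    (B.card : ℝ) ≤ 8 * Real.log p⁻¹ := by
  set N : ℝ := ((2 : ℝ) ^ Fintype.card ι)⁻¹ with hN
  have hN0 : 0 < N := by positivity
  set X : (ι → Bool) → ℝ := fun U => ∑ v ∈ B, if U v = s v then 1 else -1 with hX
  -- the conditional mean, multiplied by `p`
  have hmean : B.card * (p / 2) ≤ ∑ U, N * r U * X U := by
    simp only [hX, Finset.mul_sum]
    rw [Finset.sum_comm, ← nsmul_eq_mul]
    refine Finset.card_nsmul_le_sum _ _ _ fun v hv => ?_
    have h1 : ∑ U, N * r U * (if U v = s v then (1 : ℝ) else -1) =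
        2 * (∑ U with U v = s v, N * r U) - p := by
      rw [hpr, Finset.sum_filter, Finset.mul_sum, ← Finset.sum_sub_distrib]
      refine Finset.sum_congr rfl fun U _ => ?_
      split_ifs <;> ring
    rw [h1]
    linarith [hB v hv]
  -- the exponent `t = 1/2` balances the mean `t |B| / 2` against the moment bound `t ^ 2 |B| / 2`
  have hjen := convexOn_exp.map_sum_le (t := Finset.univ) (w := fun U => N * r U / p)
    (p := fun U => 1 / 2 * X U)
    (fun U _ => div_nonneg (mul_nonneg hN0.le (hr0 U)) hp.le)
    (by rw [← Finset.sum_div, ← hpr, div_self hp.ne']) (fun _ _ => Set.mem_univ _)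
  simp only [smul_eq_mul] at hjen
  have hup : ∑ U, N * r U / p * Real.exp (1 / 2 * X U) ≤ p⁻¹ * Real.exp (B.card * (1 / 8)) := by
    calc ∑ U, N * r U / p * Real.exp (1 / 2 * X U)
        ≤ ∑ U, N / p * Real.exp (1 / 2 * X U) := by
          refine Finset.sum_le_sum fun U _ => ?_
          gcongr
          exact mul_le_of_le_one_right hN0.le (hr1 U)
      _ = p⁻¹ * (N * ∑ U, Real.exp (1 / 2 * X U)) := by
          rw [← Finset.mul_sum]; ring
      _ ≤ _ := by
          gcongr
          refine (sum_exp_signs_le B s (1 / 2)).trans (le_of_eq ?_)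
          norm_num
  have hlow : B.card * (1 / 4 : ℝ) ≤ ∑ U, N * r U / p * (1 / 2 * X U) := by
    have : ∑ U, N * r U / p * (1 / 2 * X U) = (∑ U, N * r U * X U) / (2 * p) := by
      rw [Finset.sum_div]
      refine Finset.sum_congr rfl fun U _ => ?_
      field_simp
    rw [this, le_div_iff₀ (by positivity)]
    linarith
  have hfin := (Real.exp_le_exp.2 hlow).trans (hjen.trans hup)
  rw [← Real.exp_log (inv_pos.2 hp), ← Real.exp_add, Real.exp_le_exp] at hfin
  linarith

/-- The entropy of a random variable is at most the logarithm of the number of its values. -/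
theorem sum_mul_log_inv_le [Fintype σ] [Nonempty σ] (p : σ → ℝ) (hp : ∀ w, 0 ≤ p w)
    (hsum : ∑ w, p w = 1) : ∑ w, p w * Real.log (p w)⁻¹ ≤ Real.log (Fintype.card σ) := by
  have hn : (0 : ℝ) < Fintype.card σ := by exact_mod_cast Fintype.card_pos
  have h1 : ∀ w, p w * Real.log (p w)⁻¹ ≤
      p w * (Real.log (Fintype.card σ) - 1) + (Fintype.card σ : ℝ)⁻¹ := by
    intro w
    rcases (hp w).eq_or_lt with h | h
    · rw [← h]; simp
    · have h2 := Real.log_le_sub_one_of_pos (show 0 < (Fintype.card σ * p w)⁻¹ by positivity)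
      rw [mul_inv, Real.log_mul (by positivity) (by positivity), Real.log_inv] at h2
      calc p w * Real.log (p w)⁻¹
          ≤ p w * (Real.log (Fintype.card σ) - 1 + (Fintype.card σ : ℝ)⁻¹ * (p w)⁻¹) := by
            gcongr; linarith
        _ = _ := by field_simp
  refine (Finset.sum_le_sum fun w _ => h1 w).trans (le_of_eq ?_)
  rw [Finset.sum_add_distrib, ← Finset.sum_mul, hsum]
  simp [hn.ne']

/-- The joint law of a uniform string `U` and the memory content `w` that the randomized map `K`
computes from it. -/
def jointLaw (K : (ι → Bool) → PMF σ) (w : σ) (U : ι → Bool) : ENNReal :=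
  PMF.uniformOfFintype (ι → Bool) U * K U w

/-- The bits of the uniform string that are predictable with probability more than `3/4` from the
memory content `w`. -/
def predictable (K : (ι → Bool) → PMF σ) (w : σ) : Finset ι :=
  open Classical in
  {v | ∃ b, 3 / 4 * ∑ U, jointLaw K w U < ∑ U with U v = b, jointLaw K w U}

theorem jointLaw_ne_top (K : (ι → Bool) → PMF σ) (w : σ) (U : ι → Bool) :
    jointLaw K w U ≠ ⊤ :=
  ENNReal.mul_ne_top (PMF.apply_ne_top _ _) (PMF.apply_ne_top _ _)

theorem sum_jointLaw [Fintype σ] (K : (ι → Bool) → PMF σ) :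
    ∑ w, ∑ U, jointLaw K w U = 1 := by
  rw [Finset.sum_comm]
  simp only [jointLaw, ← Finset.mul_sum]
  simp only [← tsum_fintype (f := fun w => K _ w) (L := .unconditional _), PMF.tsum_coe, mul_one]
  rw [← tsum_fintype (L := .unconditional _)]
  exact PMF.tsum_coe _

/-- On average over the memory content, the number of predictable bits is at most linear in the
memory size. -/
theorem sum_card_predictable_le [Fintype σ] [Nonempty σ] (K : (ι → Bool) → PMF σ) :
    ∑ w, (∑ U, jointLaw K w U).toReal * (predictable K w).card
      ≤ 8 * Real.log (Fintype.card σ) := by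
  set p : σ → ℝ := fun w => (∑ U, jointLaw K w U).toReal with hp
  have hreal : ∀ w U, (jointLaw K w U).toReal =
      ((2 : ℝ) ^ Fintype.card ι)⁻¹ * (K U w).toReal := by
    intro w U
    simp [jointLaw, ENNReal.toReal_mul]
  have hsum : ∑ w, p w = 1 := by
    rw [hp, ← ENNReal.toReal_sum, sum_jointLaw, ENNReal.toReal_one]
    exact fun w _ => ENNReal.sum_ne_top.2 fun U _ => jointLaw_ne_top K w U
  have hkey : ∀ w, p w * (predictable K w).card ≤ 8 * (p w * Real.log (p w)⁻¹) := by
    intro w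
    rcases (ENNReal.toReal_nonneg : 0 ≤ p w).eq_or_lt with h | h
    · rw [show p w = 0 from h.symm]; simp
    · have hmem : ∀ v, ∃ b, v ∈ predictable K w →
          3 / 4 * ∑ U, jointLaw K w U < ∑ U with U v = b, jointLaw K w U := by
        intro v
        by_cases hv : v ∈ predictable K w
        · have hv' := hv
          simp only [predictable, Finset.mem_filter, Finset.mem_univ, true_and] at hv'
          obtain ⟨b, hb⟩ := hv'
          exact ⟨b, fun _ => hb⟩
        · exact ⟨true, fun h => absurd h hv⟩
      choose s hs using hmem
      have := card_le_of_predictable (fun U => (K U w).toReal) (fun _ => ENNReal.toReal_nonneg)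
        (fun U => ENNReal.toReal_le_of_le_ofReal zero_le_one (by simpa using PMF.coe_le_one _ _))
        (p w) h (by
          simp only [hp, ← hreal]
          exact ENNReal.toReal_sum fun U _ => jointLaw_ne_top K w U)
        (predictable K w) s (fun v hv => by
          have h1 := (ENNReal.toReal_mono
            (ENNReal.sum_ne_top.2 fun U _ => jointLaw_ne_top K w U) (hs v hv).le)
          rw [ENNReal.toReal_mul, ENNReal.toReal_sum fun U _ => jointLaw_ne_top K w U] at h1
          rw [ENNReal.toReal_sum fun U _ => jointLaw_ne_top K w U] at h1
          simp only [hp, ← hreal]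
          rw [ENNReal.toReal_sum fun U _ => jointLaw_ne_top K w U]
          refine le_trans (le_of_eq ?_) h1
          norm_num)
      nlinarith
  calc _ ≤ ∑ w, 8 * (p w * Real.log (p w)⁻¹) := Finset.sum_le_sum fun w _ => hkey w
    _ ≤ _ := by
      rw [← Finset.mul_sum]
      have := sum_mul_log_inv_le p (fun _ => ENNReal.toReal_nonneg) hsum
      linarith

/-- Two bits of the uniform string that are not both predictable from `w` take any given values with
conditional probability at most `3/4`. -/
theorem sum_jointLaw_pair_le (K : (ι → Bool) → PMF σ) (w : σ) (S : Set ι) (v₀ v₁ : ι)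
    (hS : S = {v₀, v₁}) (b : Bool × Bool) :
    ∑ U with U v₀ = b.1 ∧ U v₁ = b.2, jointLaw K w U ≤
      (∑ U, jointLaw K w U) *
        (3 / 4 + {T : Set ι | T ⊆ (predictable K w : Set ι)}.indicator 1 S) := by
  by_cases hsub : S ⊆ (predictable K w : Set ι)
  · rw [Set.indicator_of_mem (by exact hsub)]
    calc _ ≤ ∑ U, jointLaw K w U :=
          Finset.sum_le_sum_of_subset (Finset.filter_subset _ _)
      _ ≤ _ := le_mul_of_one_le_right zero_le (by simp)
  · rw [Set.indicator_of_notMem (by exact hsub), add_zero, mul_comm]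
    have hcases : v₀ ∉ predictable K w ∨ v₁ ∉ predictable K w := by
      by_contra! h
      apply hsub
      rw [hS]
      rintro v (rfl | rfl)
      exacts [h.1, h.2]
    simp only [predictable, Finset.mem_filter, Finset.mem_univ, true_and, not_exists,
      not_lt] at hcases
    rcases hcases with h | h
    · refine le_trans (Finset.sum_le_sum_of_subset ?_) (h b.1)
      exact Finset.monotone_filter_right _ fun U _ hU => hU.1
    · refine le_trans (Finset.sum_le_sum_of_subset ?_) (h b.2)
      exact Finset.monotone_filter_right _ fun U _ hU => hU.2

end Bias

/-! ### The success probability of an attempt and the bits it yields -/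

theorem InteractiveHashing.ncard_preimage {k : ℕ} (H : InteractiveHashing k) {σ : Type}
    (bob : (i : Fin H.rounds) → H.Coin i → σ → PMF (H.Ans i × σ)) (s : σ)
    {x : ((i : Fin H.rounds) → H.Coin i) × ((i : Fin H.rounds) → H.Ans i) × σ}
    (hx : x ∈ (H.execute bob s).support) : (H.preimage x.1 x.2.1).ncard = 2 := by
  simp only [InteractiveHashing.execute, PMF.mem_support_bind_iff, PMF.mem_support_map_iff] at hx
  obtain ⟨h, hh, ys, -, rfl⟩ := hx
  exact H.two_to_one h hh ys.1

/-- The security hypothesis for `β = |B| / k`. The case `B = ∅`, where `β = 0`, holds because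
preimages are nonempty. -/
theorem InteractiveHashing.preimage_subset_le {k : ℕ} [NeZero k] (H : InteractiveHashing k) {L : ℝ}
    (hH : ∀ β : ℝ, 0 < β → H.IsSecure (L * β) β) (B : Finset (Fin k)) {σ : Type}
    (bob : (i : Fin H.rounds) → H.Coin i → σ → PMF (H.Ans i × σ)) (s : σ) :
    (H.execute bob s).toOuterMeasure {x | H.preimage x.1 x.2.1 ⊆ (B : Set (Fin k))}
      ≤ ENNReal.ofReal (L * (B.card / k)) := by
  have hk : (0 : ℝ) < k := by exact_mod_cast Nat.pos_of_ne_zero (NeZero.ne k)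
  rcases B.eq_empty_or_nonempty with rfl | hB
  · refine le_of_eq_of_le ?_ zero_le
    rw [PMF.toOuterMeasure_apply_eq_zero_iff, Set.disjoint_left]
    intro x hx hsub
    have h2 := H.ncard_preimage bob s hx
    rw [Set.subset_empty_iff.1 (hsub.trans (by simp)), Set.ncard_empty] at h2
    exact absurd h2 (by norm_num)
  · refine hH _ (div_pos (by exact_mod_cast hB.card_pos) hk) B (le_of_eq ?_) σ bob s
    field_simp

open Classical in
theorem sum_pair_eq {k : ℕ} (S : Set (Fin k)) (hS : S.ncard = 2) (c : ENNReal) :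
    ∑ v₀, ∑ v₁, (if S = {v₀, v₁} then c else 0) = 2 * c := by
  obtain ⟨a, b, hab, rfl⟩ := Set.ncard_eq_two.1 hS
  have h1 : ∀ v₀ v₁ : Fin k, (if ({a, b} : Set (Fin k)) = {v₀, v₁} then c else 0) =
      (if v₀ = a then if v₁ = b then c else 0 else 0) +
        if v₀ = b then if v₁ = a then c else 0 else 0 := by
    intro v₀ v₁
    simp only [Set.pair_eq_pair_iff]
    by_cases h0a : v₀ = a
    · simp [h0a, hab, hab.symm, eq_comm]
    · by_cases h0b : v₀ = b
      · simp [h0b, hab, hab.symm, eq_comm]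
      · simp [h0a, h0b, Ne.symm h0a, Ne.symm h0b]
  simp only [h1, Finset.sum_add_distrib]
  simp [two_mul]

theorem sum_tsum_mul_ite {α σ : Type} [Fintype σ] [DecidableEq σ] (p : α → ENNReal) (g : α → σ)
    (c : α → ENNReal) :
    ∑ w, ∑' x, p x * (if g x = w then c x else 0) = ∑' x, p x * c x := by
  rw [← tsum_fintype (L := .unconditional _), ENNReal.tsum_comm]
  refine tsum_congr fun x => ?_
  rw [ENNReal.tsum_mul_left, tsum_fintype, Finset.sum_ite_eq, if_pos (Finset.mem_univ _)]

section Attempt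

variable {m k : ℕ} [NeZero k] (H : InteractiveHashing k) (A : Adversary m H)

/-- The adversary's memory after reading the stream `U`. -/
def memoryAfterStream (pos : Position) (w : Memory m) (U : Fin k → Bool) : PMF (Memory m) :=
  runSteps k (fun i => A.read pos i (U i)) w

open Classical in
/-- The indices `v₀, v₁` are independent of the stream, of the memory `w'` after the stream and of
the transcript, so they can be drawn last. -/
theorem attempt_some_apply (pos : Position) (w : Memory m) (b : Bool × Bool) (wpost : Memory m) :
    attempt H A pos w (some b, wpost) =
      ∑ w', ∑' x, H.execute (A.answer pos) w' x * (if x.2.2 = wpost then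
        ∑ v₀, ∑ v₁, (if H.preimage x.1 x.2.1 = {v₀, v₁} then (k : ENNReal)⁻¹ * (k : ENNReal)⁻¹ *
          ∑ U with U v₀ = b.1 ∧ U v₁ = b.2,
            jointLaw (memoryAfterStream H A pos w) w' U else 0) else 0) := by
  have h1 : ∀ (v₀ v₁ : Fin k) (U : Fin k → Bool) (w' : Memory m),
      ((H.execute (A.answer pos) w').map fun x =>
        ((if H.preimage x.1 x.2.1 = {v₀, v₁} then some (U v₀, U v₁) else none : Option _), x.2.2))
          (some b, wpost) =
      ∑' x, H.execute (A.answer pos) w' x * (if x.2.2 = wpost then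
        if H.preimage x.1 x.2.1 = {v₀, v₁} then
          if U v₀ = b.1 ∧ U v₁ = b.2 then 1 else 0 else 0 else 0) := by
    intro v₀ v₁ U w'
    rw [PMF.map_apply]
    refine tsum_congr fun x => ?_
    obtain ⟨b₀, b₁⟩ := b
    by_cases hw : x.2.2 = wpost
    · by_cases hp : H.preimage x.1 x.2.1 = {v₀, v₁} <;> simp [hw, hp, eq_comm]
    · simp [hw, Ne.symm hw]
  have hread : ∀ U, runSteps k (fun i => A.read pos i (U i)) w = memoryAfterStream H A pos w U :=
    fun _ => rfl
  simp only [attempt, PMF.bind_apply, h1, tsum_fintype, hread]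
  simp only [PMF.uniformOfFintype_apply (α := Fin k), Fintype.card_fin, Finset.mul_sum,
    ← ENNReal.tsum_mul_left]
  -- move the sums over the memory and the transcript to the front
  have hswap : ∀ F : Fin k → Fin k → (Fin k → Bool) → Memory m →
      ((i : Fin H.rounds) → H.Coin i) × ((i : Fin H.rounds) → H.Ans i) × Memory m → ENNReal,
      ∑ v₀, ∑ v₁, ∑ U, ∑ w', ∑' x, F v₀ v₁ U w' x =
        ∑ w', ∑' x, ∑ v₀, ∑ v₁, ∑ U, F v₀ v₁ U w' x := by
    intro F
    simp only [← tsum_fintype (L := .unconditional _)]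
    calc _ = ∑' v₀, ∑' v₁, ∑' w', ∑' U, ∑' x, F v₀ v₁ U w' x := by
          refine tsum_congr fun _ => tsum_congr fun _ => ENNReal.tsum_comm
      _ = ∑' v₀, ∑' w', ∑' v₁, ∑' U, ∑' x, F v₀ v₁ U w' x :=
          tsum_congr fun _ => ENNReal.tsum_comm
      _ = ∑' w', ∑' v₀, ∑' v₁, ∑' U, ∑' x, F v₀ v₁ U w' x := ENNReal.tsum_comm
      _ = ∑' w', ∑' v₀, ∑' v₁, ∑' x, ∑' U, F v₀ v₁ U w' x :=
          tsum_congr fun _ => tsum_congr fun _ => tsum_congr fun _ => ENNReal.tsum_comm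
      _ = ∑' w', ∑' v₀, ∑' x, ∑' v₁, ∑' U, F v₀ v₁ U w' x :=
          tsum_congr fun _ => tsum_congr fun _ => ENNReal.tsum_comm
      _ = _ := tsum_congr fun _ => ENNReal.tsum_comm
  rw [hswap]
  refine Finset.sum_congr rfl fun w' _ => tsum_congr fun x => ?_
  by_cases hw : x.2.2 = wpost
  · simp only [hw, if_true, Finset.mul_sum]
    refine Finset.sum_congr rfl fun v₀ _ => Finset.sum_congr rfl fun v₁ _ => ?_
    by_cases hp : H.preimage x.1 x.2.1 = {v₀, v₁}
    · simp only [hp, if_true, Finset.sum_filter, Finset.mul_sum]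
      refine Finset.sum_congr rfl fun U _ => ?_
      split_ifs
      · simp only [jointLaw]; ring
      · simp
    · simp [hp]
  · simp [hw]

/-- Every attempt succeeds with probability `2 / k²`. -/
theorem attempt_success (pos : Position) (w : Memory m) :
    ∑' x : (Bool × Bool) × Memory m, attempt H A pos w (some x.1, x.2) =
      2 * ((k : ENNReal)⁻¹ * (k : ENNReal)⁻¹) := by
  classical
  set c : ENNReal := (k : ENNReal)⁻¹ * (k : ENNReal)⁻¹
  rw [ENNReal.tsum_prod', ENNReal.tsum_comm]
  simp only [tsum_fintype]
  set J : Memory m → ENNReal := fun w' => ∑ U, jointLaw (memoryAfterStream H A pos w) w' U with hJ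
  have hfib : ∀ (w' : Memory m) (v₀ v₁ : Fin k), ∑ b : Bool × Bool,
      ∑ U with U v₀ = b.1 ∧ U v₁ = b.2, jointLaw (memoryAfterStream H A pos w) w' U = J w' := by
    intro w' v₀ v₁
    simp only [hJ]
    rw [← Finset.sum_fiberwise (s := Finset.univ) (g := fun U : Fin k → Bool => (U v₀, U v₁))]
    refine Finset.sum_congr rfl fun b _ => ?_
    congr 1
    ext U
    simp [Prod.ext_iff]
  have hin : ∀ wpost, ∑ b, attempt H A pos w (some b, wpost) =
      ∑ w', ∑' x, H.execute (A.answer pos) w' x *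
        (if x.2.2 = wpost then 2 * (c * J w') else 0) := by
    intro wpost
    simp only [attempt_some_apply]
    rw [Finset.sum_comm]
    refine Finset.sum_congr rfl fun w' _ => ?_
    rw [← tsum_fintype (L := .unconditional _), ENNReal.tsum_comm]
    refine tsum_congr fun x => ?_
    rw [tsum_fintype, ← Finset.mul_sum]
    by_cases hx : x ∈ (H.execute (A.answer pos) w').support
    · congr 1
      split_ifs
      · rw [← sum_pair_eq _ (H.ncard_preimage _ _ hx), Finset.sum_comm]
        refine Finset.sum_congr rfl fun v₀ _ => ?_
        rw [Finset.sum_comm]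
        refine Finset.sum_congr rfl fun v₁ _ => ?_
        split_ifs
        · rw [← Finset.mul_sum, hfib]
        · simp
      · simp
    · rw [(PMF.apply_eq_zero_iff _ _).2 hx, zero_mul, zero_mul]
  simp only [hin]
  rw [Finset.sum_comm]
  calc _ = ∑ w', 2 * (c * J w') := by
        refine Finset.sum_congr rfl fun w' _ => ?_
        rw [sum_tsum_mul_ite, ENNReal.tsum_mul_right, PMF.tsum_coe, one_mul]
    _ = _ := by
        rw [← Finset.mul_sum, ← Finset.mul_sum, sum_jointLaw, mul_one]

/-- If interactive hashing is secure enough for a memory of `m` bits, then the success of an attempt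
together with a correct guess of both stored bits from the memory has probability at most `7/8`
times that of the success. Here `L / k` times the mean number of predictable bits, which is at most
`8 m`, bounds the probability that both bits are predictable, so `64 L m ≤ k` makes it at most
`1/8`. -/
theorem attempt_guess_le {L : ℝ} (hL : 0 ≤ L) (hH : ∀ β : ℝ, 0 < β → H.IsSecure (L * β) β)
    (hm : 64 * L * m ≤ k) (pos : Position) (w : Memory m) :
    ∑' wpost, ⨆ b, attempt H A pos w (some b, wpost) ≤
      7 / 8 * ∑' x : (Bool × Bool) × Memory m, attempt H A pos w (some x.1, x.2) := by
  classical
  have hk : (0 : ℝ) < k := by exact_mod_cast Nat.pos_of_ne_zero (NeZero.ne k)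
  rw [attempt_success]
  set c : ENNReal := (k : ENNReal)⁻¹ * (k : ENNReal)⁻¹
  set K := memoryAfterStream H A pos w with hK
  set J : Memory m → ENNReal := fun w' => ∑ U, jointLaw K w' U with hJ
  set I : Memory m → Set (Fin k) → ENNReal := fun w' =>
    {T : Set (Fin k) | T ⊆ (predictable K w' : Set (Fin k))}.indicator 1 with hI
  have hsup : ∀ wpost, ⨆ b, attempt H A pos w (some b, wpost) ≤
      ∑ w', ∑' x, H.execute (A.answer pos) w' x *
        (if x.2.2 = wpost then 2 * (c * (J w' * (3 / 4 + I w' (H.preimage x.1 x.2.1)))) else 0) := by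
    refine fun wpost => iSup_le fun b => ?_
    rw [attempt_some_apply]
    refine Finset.sum_le_sum fun w' _ => ENNReal.tsum_le_tsum fun x => ?_
    by_cases hx : x ∈ (H.execute (A.answer pos) w').support
    · refine mul_le_mul_right ?_ _
      split_ifs
      · rw [← sum_pair_eq _ (H.ncard_preimage _ _ hx)]
        refine Finset.sum_le_sum fun v₀ _ => Finset.sum_le_sum fun v₁ _ => ?_
        split_ifs with hS
        · exact mul_le_mul_right (sum_jointLaw_pair_le K w' _ v₀ v₁ hS b) _
        · exact le_rfl
      · exact le_rfl
    · rw [(PMF.apply_eq_zero_iff _ _).2 hx, zero_mul, zero_mul]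
  have hhash : ∀ w', ∑' x, H.execute (A.answer pos) w' x * I w' (H.preimage x.1 x.2.1) ≤
      ENNReal.ofReal (L * ((predictable K w').card / k)) := by
    intro w'
    refine le_trans (le_of_eq ?_) (H.preimage_subset_le hH (predictable K w') (A.answer pos) w')
    rw [PMF.toOuterMeasure_apply]
    refine tsum_congr fun x => ?_
    simp only [hI, Set.indicator_apply, Set.mem_ofPred_eq]
    split_ifs <;> simp
  have havg : ∑ w', J w' * ENNReal.ofReal (L * ((predictable K w').card / k)) ≤ 1 / 8 := by
    have hJtop : ∀ w', J w' ≠ ⊤ := fun w' => ENNReal.sum_ne_top.2 fun U _ => jointLaw_ne_top K w' U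
    have h1 : ∀ w', J w' * ENNReal.ofReal (L * ((predictable K w').card / k)) =
        ENNReal.ofReal (L / k * ((J w').toReal * (predictable K w').card)) := by
      intro w'
      nth_rw 1 [← ENNReal.ofReal_toReal (hJtop w')]
      rw [← ENNReal.ofReal_mul ENNReal.toReal_nonneg]
      congr 1
      ring
    simp only [h1]
    rw [← ENNReal.ofReal_sum_of_nonneg fun w' _ => by positivity, ← Finset.mul_sum]
    have h2 := sum_card_predictable_le K
    have h3 : Real.log (Fintype.card (Memory m)) ≤ m := by
      simp only [Memory, Fintype.card_fun, Fintype.card_bool, Fintype.card_fin, Nat.cast_pow,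
        Nat.cast_ofNat, Real.log_pow]
      have := Real.log_two_lt_d9
      have : Real.log 2 ≤ 1 := by linarith
      exact mul_le_of_le_one_right (Nat.cast_nonneg _) this
    have h4 : L / k * ∑ w', (J w').toReal * (predictable K w').card ≤ 1 / 8 := by
      calc _ ≤ L / k * (8 * m) := by
            refine mul_le_mul_of_nonneg_left ?_ (by positivity)
            exact h2.trans (by linarith)
        _ ≤ 1 / 8 := by
            rw [div_mul_eq_mul_div, div_le_iff₀ hk]
            linarith
    calc _ ≤ ENNReal.ofReal (1 / 8) := ENNReal.ofReal_le_ofReal h4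
      _ = 1 / 8 := by
        rw [ENNReal.ofReal_div_of_pos (by norm_num)]; simp
  calc ∑' wpost, ⨆ b, attempt H A pos w (some b, wpost)
      ≤ ∑' wpost, ∑ w', ∑' x, H.execute (A.answer pos) w' x * (if x.2.2 = wpost then
          2 * (c * (J w' * (3 / 4 + I w' (H.preimage x.1 x.2.1)))) else 0) :=
        ENNReal.tsum_le_tsum hsup
    _ = ∑ w', ∑' x, H.execute (A.answer pos) w' x *
          (2 * (c * (J w' * (3 / 4 + I w' (H.preimage x.1 x.2.1))))) := by
        rw [tsum_fintype, Finset.sum_comm]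
        exact Finset.sum_congr rfl fun w' _ => sum_tsum_mul_ite _ _ _
    _ = ∑ w', 2 * (c * (J w' * (3 / 4 +
          ∑' x, H.execute (A.answer pos) w' x * I w' (H.preimage x.1 x.2.1)))) := by
        refine Finset.sum_congr rfl fun w' _ => ?_
        have h34 : (3 / 4 : ENNReal) = ∑' x, H.execute (A.answer pos) w' x * (3 / 4) := by
          rw [ENNReal.tsum_mul_right, PMF.tsum_coe, one_mul]
        nth_rw 2 [h34]
        rw [← ENNReal.tsum_add]
        simp only [← ENNReal.tsum_mul_left]
        refine tsum_congr fun x => ?_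
        ring
    _ ≤ ∑ w', 2 * (c * (J w' * (3 / 4 +
          ENNReal.ofReal (L * ((predictable K w').card / k))))) := by
        gcongr with w' _
        exact hhash w'
    _ = 2 * (c * (3 / 4 + ∑ w', J w' * ENNReal.ofReal (L * ((predictable K w').card / k)))) := by
        simp only [← Finset.mul_sum, mul_add, Finset.sum_add_distrib]
        rw [← Finset.sum_mul, sum_jointLaw, one_mul]
    _ ≤ 2 * (c * (3 / 4 + 1 / 8)) := by gcongr
    _ = 7 / 8 * (2 * c) := by
        have : (3 / 4 + 1 / 8 : ENNReal) = 7 / 8 := by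
          rw [← ENNReal.toReal_eq_toReal_iff' (by finiteness) (by finiteness),
            ENNReal.toReal_add (by finiteness) (by finiteness)]
          norm_num
        rw [this]; ring

end Attempt

/-! ### Guessing all stored bits -/

section Rounds

variable {m k : ℕ} [NeZero k] (H : InteractiveHashing k) (A : Adversary m H)

/-- A bound on the guessing probability in each successful attempt is inherited by the round, even
if the index of the successful attempt is known. -/
theorem round_guess_le {γ : ENNReal}
    (hγ : ∀ pos w, ∑' w', ⨆ b, attempt H A pos w (some b, w') ≤
      γ * ∑' x : (Bool × Bool) × Memory m, attempt H A pos w (some x.1, x.2))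
    (past : List ℕ) (w : Memory m) :
    ∑' a, ∑' w', ⨆ b, round H A past w (a, b, w') ≤ γ := by
  set f : ℕ → Memory m → PMF (Option (Bool × Bool) × Memory m) := fun a => attempt H A ⟨past, a⟩
  have happ : ∀ x, round H A past w x =
      ∑' t, pending f w x.1 t * f x.1 t (some x.2.1, x.2.2) := fun _ => rfl
  calc ∑' a, ∑' w', ⨆ b, round H A past w (a, b, w')
      ≤ ∑' a, ∑' w', ∑' t, pending f w a t * ⨆ b, f a t (some b, w') := by
        refine ENNReal.tsum_le_tsum fun a => ENNReal.tsum_le_tsum fun w' => iSup_le fun b => ?_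
        rw [happ]
        refine ENNReal.tsum_le_tsum fun t => mul_le_mul_right ?_ _
        exact le_iSup (fun b => f a t (some b, w')) b
    _ = ∑' a, ∑' t, pending f w a t * ∑' w', ⨆ b, f a t (some b, w') := by
        refine tsum_congr fun a => ?_
        rw [ENNReal.tsum_comm]
        simp only [ENNReal.tsum_mul_left]
    _ ≤ ∑' a, ∑' t, pending f w a t *
          (γ * ∑' x : (Bool × Bool) × Memory m, f a t (some x.1, x.2)) :=
        ENNReal.tsum_le_tsum fun a => ENNReal.tsum_le_tsum fun t => mul_le_mul_right (hγ _ _) _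
    _ = γ * ∑' x, round H A past w x := by
        rw [ENNReal.tsum_prod', ← ENNReal.tsum_mul_left]
        refine tsum_congr fun a => ?_
        simp only [happ]
        rw [ENNReal.tsum_comm, ← ENNReal.tsum_mul_left]
        refine tsum_congr fun t => ?_
        rw [ENNReal.tsum_mul_left]
        ring
    _ = γ := by rw [PMF.tsum_coe, mul_one]

/-- The guessing probability of the pairs of `j` rounds, given the memory and the indices of the
successful attempts, is at most the product of the bounds for single rounds. -/
theorem run_guess_le {γ : ENNReal}
    (hγ : ∀ past w, ∑' a, ∑' w', ⨆ b, round H A past w (a, b, w') ≤ γ) (j : ℕ) :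
    ∑' past, ∑' w, ⨆ z, run H A j (past, z, w) ≤ γ ^ j := by
  induction j with
  | zero =>
    rw [pow_zero, ← (run H A 0).tsum_coe, ENNReal.tsum_prod']
    refine ENNReal.tsum_le_tsum fun past => ?_
    rw [ENNReal.tsum_prod', ENNReal.tsum_comm]
    exact ENNReal.tsum_le_tsum fun w => iSup_le fun z =>
      ENNReal.le_tsum (f := fun z => run H A 0 (past, z, w)) z
  | succ j ih =>
    -- the earlier pairs and the last one are guessed separately, given the memory in between
    have hstep : ∀ past' w' z, run H A (j + 1) (past', z, w') ≤
        ∑' past, ∑' w, ∑' a, if past' = past ++ [a] then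
          (⨆ z, run H A j (past, z, w)) * ⨆ b, round H A past w (a, b, w') else 0 := by
      intro past' w' z
      have hmap : ∀ x : List ℕ × (Fin j → Bool × Bool) × Memory m,
          ((round H A x.1 x.2.2).map fun y =>
            (x.1 ++ [y.1], (Fin.snoc x.2.1 y.2.1 : Fin (j + 1) → Bool × Bool), y.2.2))
              (past', z, w') ≤
          if x.2.1 = Fin.init z then ∑' a, if past' = x.1 ++ [a] then
            ⨆ b, round H A x.1 x.2.2 (a, b, w') else 0 else 0 := by
        intro x
        rw [PMF.map_apply, ENNReal.tsum_prod']
        split_ifs with hz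
        · refine ENNReal.tsum_le_tsum fun a => ?_
          rw [tsum_eq_single (z (Fin.last j), w')]
          · simp only [Prod.mk.injEq]
            by_cases hp : past' = x.1 ++ [a]
            · simp only [hp, hz, if_true, true_and]
              split_ifs
              · exact le_iSup (fun b => round H A x.1 x.2.2 (a, b, w')) _
              · exact zero_le
            · simp [hp]
          · intro y hy
            rw [if_neg]
            intro h
            simp only [Prod.mk.injEq] at h
            apply hy
            obtain ⟨-, h2, h3⟩ := h
            ext1
            · simp [h2]
            · exact h3.symm
        · refine le_of_eq ?_
          simp only [ENNReal.tsum_eq_zero]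
          intro a y
          rw [if_neg]
          intro h
          simp only [Prod.mk.injEq] at h
          apply hz
          rw [h.2.1, Fin.init_snoc]
      simp only [run, PMF.bind_apply]
      rw [ENNReal.tsum_prod']
      refine ENNReal.tsum_le_tsum fun past => ?_
      rw [ENNReal.tsum_prod', ENNReal.tsum_comm]
      refine ENNReal.tsum_le_tsum fun w => ?_
      calc _ ≤ ∑' z', run H A j (past, z', w) * (if z' = Fin.init z then
              ∑' a, if past' = past ++ [a] then
                ⨆ b, round H A past w (a, b, w') else 0 else 0) :=
            ENNReal.tsum_le_tsum fun z' => mul_le_mul_right (hmap (past, z', w)) _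
        _ = run H A j (past, Fin.init z, w) * ∑' a, if past' = past ++ [a] then
                ⨆ b, round H A past w (a, b, w') else 0 := by
            rw [tsum_eq_single (Fin.init z)]
            · simp
            · intro z' hz'
              simp [hz']
        _ ≤ (⨆ z, run H A j (past, z, w)) * ∑' a, if past' = past ++ [a] then
                ⨆ b, round H A past w (a, b, w') else 0 :=
            mul_le_mul_left (le_iSup (fun z => run H A j (past, z, w)) _) _
        _ = _ := by
            rw [← ENNReal.tsum_mul_left]
            refine tsum_congr fun a => ?_
            split_ifs <;> simp
    calc ∑' past', ∑' w', ⨆ z, run H A (j + 1) (past', z, w')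
        ≤ ∑' past', ∑' w', ∑' past, ∑' w, ∑' a, if past' = past ++ [a] then
          (⨆ z, run H A j (past, z, w)) * ⨆ b, round H A past w (a, b, w') else 0 :=
          ENNReal.tsum_le_tsum fun past' => ENNReal.tsum_le_tsum fun w' =>
            iSup_le fun z => hstep past' w' z
      _ = ∑' past, ∑' w, ∑' a, ∑' w', ∑' past', if past' = past ++ [a] then
          (⨆ z, run H A j (past, z, w)) * ⨆ b, round H A past w (a, b, w') else 0 := by
          rw [ENNReal.tsum_comm]
          calc _ = ∑' w', ∑' past, ∑' past', ∑' w, ∑' a, if past' = past ++ [a] then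
                (⨆ z, run H A j (past, z, w)) * ⨆ b, round H A past w (a, b, w') else 0 :=
                tsum_congr fun _ => ENNReal.tsum_comm
            _ = ∑' past, ∑' w', ∑' past', ∑' w, ∑' a, if past' = past ++ [a] then
                (⨆ z, run H A j (past, z, w)) * ⨆ b, round H A past w (a, b, w') else 0 :=
                ENNReal.tsum_comm
            _ = ∑' past, ∑' w', ∑' w, ∑' past', ∑' a, if past' = past ++ [a] then
                (⨆ z, run H A j (past, z, w)) * ⨆ b, round H A past w (a, b, w') else 0 :=
                tsum_congr fun _ => tsum_congr fun _ => ENNReal.tsum_comm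
            _ = ∑' past, ∑' w, ∑' w', ∑' past', ∑' a, if past' = past ++ [a] then
                (⨆ z, run H A j (past, z, w)) * ⨆ b, round H A past w (a, b, w') else 0 :=
                tsum_congr fun _ => ENNReal.tsum_comm
            _ = ∑' past, ∑' w, ∑' w', ∑' a, ∑' past', if past' = past ++ [a] then
                (⨆ z, run H A j (past, z, w)) * ⨆ b, round H A past w (a, b, w') else 0 :=
                tsum_congr fun _ => tsum_congr fun _ => tsum_congr fun _ => ENNReal.tsum_comm
            _ = _ := tsum_congr fun _ => tsum_congr fun _ => ENNReal.tsum_comm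
      _ = ∑' past, ∑' w, (⨆ z, run H A j (past, z, w)) *
            ∑' a, ∑' w', ⨆ b, round H A past w (a, b, w') := by
          simp only [tsum_ite_eq, ENNReal.tsum_mul_left]
      _ ≤ ∑' past, ∑' w, (⨆ z, run H A j (past, z, w)) * γ :=
          ENNReal.tsum_le_tsum fun past => ENNReal.tsum_le_tsum fun w =>
            mul_le_mul_right (hγ past w) _
      _ = (∑' past, ∑' w, ⨆ z, run H A j (past, z, w)) * γ := by
          simp only [ENNReal.tsum_mul_right]
      _ ≤ γ ^ j * γ := mul_le_mul_left ih _
      _ = γ ^ (j + 1) := (pow_succ _ _).symm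

/-- Forgetting the indices of the successful attempts does not help to guess. -/
theorem clawLaw_guess_le (n : ℕ) :
    ∑' w, ⨆ z, clawLaw H A n (z, w) ≤ ∑' past, ∑' w, ⨆ z, run H A n (past, z, w) := by
  rw [ENNReal.tsum_comm]
  refine ENNReal.tsum_le_tsum fun w => iSup_le fun z => ?_
  rw [clawLaw, PMF.map_apply, ENNReal.tsum_prod']
  refine ENNReal.tsum_le_tsum fun past => ?_
  rw [tsum_eq_single ((fun j => (z.1 j, z.2 j)), w)]
  · split_ifs
    · exact le_iSup (fun z => run H A n (past, z, w)) _
    · exact zero_le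
  · intro x hx
    rw [if_neg]
    rintro h
    apply hx
    obtain ⟨rfl, rfl⟩ := Prod.ext_iff.1 h
    rfl

end Rounds

/-- A bound on the guessing probability is a bound on the conditional min-entropy. -/
theorem le_condMinEntropy {α β : Type} [Fintype α] [Fintype β] (p : PMF (α × β)) {g : ℝ}
    (hg : 0 ≤ g) (h : ∑' y, ⨆ x, p (x, y) ≤ ENNReal.ofReal g) :
    -Real.logb 2 g ≤ condMinEntropy p := by
  have hsnd : ∀ y, p.map Prod.snd y = ∑' x, p (x, y) := by
    intro y
    rw [PMF.map_apply, ENNReal.tsum_prod']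
    refine tsum_congr fun x => ?_
    rw [tsum_eq_single y]
    · simp
    · intro y' hy'
      simp [Ne.symm hy']
  have hle : ∀ x y, p (x, y) ≤ p.map Prod.snd y := fun x y => by
    rw [hsnd]; exact ENNReal.le_tsum (f := fun x => p (x, y)) x
  obtain ⟨⟨x₀, -⟩, -⟩ := p.support_nonempty
  have : Nonempty α := ⟨x₀⟩
  have hsup : ∀ y, (⨆ x, p (x, y)).toReal = ⨆ x, (p (x, y)).toReal := fun y =>
    ENNReal.toReal_iSup fun x => p.apply_ne_top _
  have hterm : ∀ y, (p.map Prod.snd y).toReal *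
      ⨆ x, (p (x, y)).toReal / (p.map Prod.snd y).toReal = (⨆ x, p (x, y)).toReal := by
    intro y
    rw [hsup, Real.mul_iSup_of_nonneg ENNReal.toReal_nonneg]
    congr 1
    funext x
    by_cases h0 : p.map Prod.snd y = 0
    · have : p (x, y) = 0 := le_antisymm (h0 ▸ hle x y) zero_le
      simp [h0, this]
    · exact mul_div_cancel₀ _ (ENNReal.toReal_ne_zero.2 ⟨h0, PMF.apply_ne_top _ _⟩)
  have htop : ∀ y, ⨆ x, p (x, y) ≠ ⊤ := fun y =>
    ne_top_of_le_ne_top ENNReal.one_ne_top (iSup_le fun x => p.coe_le_one _)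
  rw [condMinEntropy, neg_le_neg_iff]
  simp only [hterm]
  rw [← ENNReal.toReal_sum fun y _ => htop y]
  rw [tsum_fintype] at h
  refine Real.logb_le_logb_of_le one_lt_two ?_ (ENNReal.toReal_le_of_le_ofReal hg h)
  refine ENNReal.toReal_pos ?_ (ENNReal.sum_ne_top.2 fun y _ => htop y)
  -- the guessing probability is nonzero, so that its logarithm is not a junk value
  obtain ⟨⟨x, y⟩, hxy⟩ := p.support_nonempty
  intro h0
  rw [Finset.sum_eq_zero_iff] at h0
  have h1 := h0 y (Finset.mem_univ y)
  rw [ENNReal.iSup_eq_zero] at h1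
  exact hxy (h1 x)

end ClawGen

end

theorem mainTheorem5 (C c : ℝ) (hC : 0 < C) (hc : 0 < c) :
    ∃ c' : ℝ, 0 < c' ∧ ∃ lam₀ : ℕ, ∀ lam : ℕ, lam₀ ≤ lam →
      ∀ (m k : ℕ) [NeZero k], (lam : ℝ) * (m + c * lam) < k / Real.logb 2 k →
        ∀ H : ClawGen.InteractiveHashing k,
          (∀ β : ℝ, 0 < β → H.IsSecure (C * β * Real.logb 2 k) β) →
          ∀ A : ClawGen.Adversary m H,
            c' * lam ≤ ClawGen.condMinEntropy (ClawGen.clawLaw H A lam) := by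
  refine ⟨-Real.logb 2 (7 / 8), neg_pos.2 (Real.logb_neg one_lt_two (by norm_num) (by norm_num)),
    ⌈64 * C⌉₊, fun lam hlam m k _ hk H hH A => ?_⟩
  have hlam' : 64 * C ≤ lam := (Nat.le_ceil _).trans (by exact_mod_cast hlam)
  have hk1 : (1 : ℝ) ≤ k := by exact_mod_cast Nat.one_le_iff_ne_zero.2 (NeZero.ne k)
  have hlog0 : 0 ≤ Real.logb 2 k := Real.logb_nonneg one_lt_two hk1
  -- for `k = 1` the quotient `k / log k` is `0`, which the hypothesis rules out
  have hlog : 0 < Real.logb 2 k := by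
    refine hlog0.lt_of_ne fun h => ?_
    rw [← h, div_zero] at hk
    exact absurd hk (not_lt.2 (by positivity))
  have hm : 64 * (C * Real.logb 2 k) * m ≤ k := by
    rw [lt_div_iff₀ hlog] at hk
    calc 64 * (C * Real.logb 2 k) * m = 64 * C * (m * Real.logb 2 k) := by ring
      _ ≤ lam * (m * Real.logb 2 k) := by gcongr
      _ = lam * (m + 0) * Real.logb 2 k := by ring
      _ ≤ lam * (m + c * lam) * Real.logb 2 k := by gcongr; positivity
      _ ≤ k := hk.le
  have hguess := (ClawGen.clawLaw_guess_le H A lam).trans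
    (ClawGen.run_guess_le H A
      (ClawGen.round_guess_le H A
        (ClawGen.attempt_guess_le H A (mul_nonneg hC.le hlog0)
          (fun β hβ => by simpa only [mul_right_comm] using hH β hβ) hm)) lam)
  have hreal : (7 / 8 : ENNReal) ^ lam = ENNReal.ofReal ((7 / 8) ^ lam) := by
    rw [ENNReal.ofReal_pow (by norm_num), ENNReal.ofReal_div_of_pos (by norm_num)]
    simp
  rw [hreal] at hguess
  refine le_trans (le_of_eq ?_) (ClawGen.le_condMinEntropy _ (by positivity) hguess)
  rw [Real.logb_pow]
  ring
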